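/- **Conventions.** A function $g\in\omega^\omega$ is increasing if $g(m)<g(n)$ whenever $m<n$, and $g\le^* f$ means that $g(n)\le f(n)$ for all but finitely many $n$. All ultrafilters on $\omega$ are non-principal. $\mathcal P(\omega)$ carries the topology of the Cantor space $2^\omega$. For a cardinal $\kappa$, $H(\kappa)$ is the collection of all sets whose transitive closure has size less than $\kappa$. Once a well order $\trianglelefteq$ of $H(\kappa)$ is fixed, $\mathrm{Sub}(\kappa)$ is the family of all countable $M\subseteq H(\kappa)$ such that $(M,\in,\trianglelefteq)$ is an elementary submodel of $(H(\kappa),\in,\trianglelefteq)$; the height of $M\in\mathrm{Sub}(\kappa)$ is the countable ordinal $\delta_M=M\cap\omega_1$. A set of countable subsets of $H(\kappa)$ is stationary if it meets every family of countable subsets of $H(\kappa)$ that is cofinal under inclusion and closed under unions of increasing $\omega$-sequences. A relation $R\subseteq X^m\times\omega^\omega$ is $\le^*$-adequate if for all $x_1,\dots,x_m\in X$ there is $f\in\omega^\omega$ such that $R(x_1,\dots,x_m,g)$ holds for every increasing $g\in\omega^\omega$ with $g\not\le^* f$. A *multiple $\mathfrak d$-pathway* is a pair $(\mathcal B,\mathcal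 S)$ for which there are a regular cardinal $\kappa>\mathfrak c$ and a well order $\trianglelefteq$ of $H(\kappa)$ such that $\mathcal B=\langle f_\alpha\mid\alpha<\omega_1\rangle$ is a sequence of increasing functions in $\omega^\omega$, $\mathcal S\subseteq\mathrm{Sub}(\kappa)$ is stationary, $\mathcal B\in M$ for every $M\in\mathcal S$, and the following holds: for every $n\in\omega$, all $M_0,\dots,M_n\in\mathcal S$ with $\delta_{M_0}\le\dots\le\delta_{M_n}$, every projective $\le^*$-adequate relation $R\subseteq(\omega^\omega)^{n+1}\times\omega^\omega$ with $R\in M_n$, and all $x_i\in M_i\cap\omega^\omega$ ($i\le n$), the relation $R(x_0,\dots,x_n,f_{\delta_{M_n}})$ holds. An ultrafilter $\mathcal U$ on $\omega$ is a *strong P-point* if for every sequence $\langle\mathcal C_n\rangle_{n\in\omega}$ of compact subsets of $\mathcal P(\omega)$ with $\mathcal C_n\subseteq\mathcal U$ for all $n$, there is a partition $\langle P_n\rangle_{n\in\omega}$ of $\omega$ into consecutive nonempty finite intervals, $P_n=[k_n,k_{n+1})$ with $0=k_0<k_1<k_2<\cdots$, such that $$\{A\subseteq\omega\mid\forall n\in\omega\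 \exists X_n\in\mathcal C_n\ (A\cap P_n=X_n\cap P_n)\}\subseteq\mathcal U .$$ **Theorem.** If there is a multiple $\mathfrak d$-pathway, then there is a strong P-point. -/

import Mathlib

universe u

namespace DPathway

/-! ### Coding of the objects in question as sets -/

/-- The von Neumann natural number `n`. -/
noncomputable def natCode (n : ℕ) : ZFSet.{u} :=
  Ordinal.toZFSet (n : Ordinal.{u})

/-- A function `ω → ω` as a set of ordered pairs. -/
noncomputable def realCode (g : ℕ → ℕ) : ZFSet.{u} :=
  ZFSet.range fun n : ℕ => ZFSet.pair (natCode.{u} n) (natCode.{u} (g n))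

/-- A finite sequence `⟨x₀, …, x_{m-1}⟩` of functions `ω → ω`, as a function with domain `m`. -/
noncomputable def tupleCode {m : ℕ} (x : Fin m → ℕ → ℕ) : ZFSet.{u} :=
  ZFSet.range fun i : Fin m => ZFSet.pair (natCode.{u} (i : ℕ)) (realCode.{u} (x i))

/-- A relation `R ⊆ (ω^ω)^m × ω^ω` as a set. -/
noncomputable def relCode {m : ℕ} (R : Set ((Fin m → ℕ → ℕ) × (ℕ → ℕ))) : ZFSet.{u} :=
  ZFSet.range fun p : R => ZFSet.pair (tupleCode.{u} p.1.1) (realCode.{u} p.1.2)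

/-- The sequence `⟨f_α | α < ω₁⟩` as a set, namely as a function with domain `ω₁`.
The values of `f` at ordinals `α ≥ ω₁` are disregarded. -/
noncomputable def seqCode (f : Ordinal.{u} → ℕ → ℕ) : ZFSet.{u} :=
  ZFSet.range fun α : Set.Iio (Ordinal.omega.{u} 1) =>
    ZFSet.pair (Ordinal.toZFSet α.1) (realCode.{u} (f α.1))

/-! ### `H(κ)` and its countable elementary submodels -/

/-- `H(κ)`: the sets whose transitive closure has size less than `κ`. The elements of the
transitive closure of `x` are the `y` with `y ∈ ⋯ ∈ x` in one or more steps. -/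
def H (κ : Cardinal.{u}) : Set ZFSet.{u} :=
  {x | Cardinal.mk {y : ZFSet.{u} // Relation.TransGen (· ∈ ·) y x} < Cardinal.lift.{u + 1, u} κ}

/-- The two binary relation symbols `∈` and `⊴`. -/
inductive Symbols : ℕ → Type
  | mem : Symbols 2
  | wo : Symbols 2

/-- The first-order language with the binary relation symbols `∈` and `⊴` only. -/
def lang : FirstOrder.Language.{0, 0} :=
  ⟨fun _ => Empty, Symbols⟩

/-- The domain of the structure `(H(κ), ∈, r)`. -/
def HModel (κ : Cardinal.{u}) (_r : H κ → H κ → Prop) : Type (u + 1) :=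
  H κ

/-- The set that an element of `(H(κ), ∈, r)` is. -/
def HModel.val {κ : Cardinal.{u}} {r : H κ → H κ → Prop} (x : HModel κ r) : ZFSet.{u} :=
  Subtype.val (p := fun y => y ∈ H κ) x

/-- The structure `(H(κ), ∈, r)`. -/
instance HModel.structure (κ : Cardinal.{u}) (r : H κ → H κ → Prop) :
    lang.Structure (HModel κ r) where
  funMap := fun f => f.elim
  RelMap := fun {_} R => match R with
    | Symbols.mem => fun x => (x 0).val ∈ (x 1).val
    | Symbols.wo => fun x => r (x 0) (x 1)

/-- `Sub(κ)`: the countable `M ⊆ H(κ)` such that `(M, ∈, r)` is an elementary submodel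
of `(H(κ), ∈, r)`. -/
def Sub (κ : Cardinal.{u}) (r : H κ → H κ → Prop) : Set (Set ZFSet.{u}) :=
  {M | M.Countable ∧ ∃ N : lang.ElementarySubstructure (HModel κ r),
    M = HModel.val '' (N : Set (HModel κ r))}

/-- The height `δ_M`, the ordinal `M ∩ ω₁`. For `M ∈ Sub(κ)` the set `M ∩ ω₁` is a countable
initial segment of `ω₁`, so this ordinal is the least ordinal that does not belong to `M`. -/
noncomputable def height (M : Set ZFSet.{u}) : Ordinal.{u} :=
  sInf {α : Ordinal.{u} | Ordinal.toZFSet α ∉ M}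

/-- Closed unbounded families of countable subsets of a set `X`. -/
structure IsClub {α : Type*} (X : Set α) (C : Set (Set α)) : Prop where
  countable_subset : ∀ N ∈ C, N ⊆ X ∧ N.Countable
  unbounded : ∀ N : Set α, N ⊆ X → N.Countable → ∃ N' ∈ C, N ⊆ N'
  closed : ∀ N : ℕ → Set α, Monotone N → (∀ k, N k ∈ C) → (⋃ k, N k) ∈ C

/-- `S` is stationary in the family of countable subsets of `X`: it meets every club. -/
def IsStationary {α : Type*} (X : Set α) (S : Set (Set α)) : Prop :=
  ∀ C : Set (Set α), IsClub X C → (S ∩ C).Nonempty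

/-! ### Projective and adequate relations -/

/-- `IsSigma k A`: the set `A` is `Σ¹_{k+1}`. The `Σ¹_1` sets are the analytic ones, and the
`Σ¹_{k+2}` subsets of `X` are the projections of the `Π¹_{k+1}` subsets of `X × ω^ω`. -/
def IsSigma : ℕ → ∀ {X : Type} [TopologicalSpace X], Set X → Prop
  | 0, _, _, A => MeasureTheory.AnalyticSet A
  | k + 1, X, _, A => ∃ B : Set (X × (ℕ → ℕ)), IsSigma k Bᶜ ∧ A = Prod.fst '' B

/-- Projective sets. -/
def IsProjective {X : Type} [TopologicalSpace X] (A : Set X) : Prop :=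
  ∃ k, IsSigma k A

/-- `≤*`-adequate relations. Here `g ≤ᶠ[atTop] f` is `g ≤* f`, and increasing functions
are strictly increasing. -/
def IsAdequate {X : Type*} {m : ℕ} (R : Set ((Fin m → X) × (ℕ → ℕ))) : Prop :=
  ∀ x : Fin m → X, ∃ f : ℕ → ℕ, ∀ g : ℕ → ℕ, StrictMono g →
    ¬ g ≤ᶠ[Filter.atTop] f → (x, g) ∈ R

/-! ### Multiple `𝔡`-pathways -/

/-- `({f_α | α < ω₁}, S)` is a multiple `𝔡`-pathway, with respect to the cardinal `κ` and
the well order `r` of `H(κ)`. -/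
structure IsMultiplePathway (κ : Cardinal.{u}) (r : H κ → H κ → Prop)
    (f : Ordinal.{u} → ℕ → ℕ) (S : Set (Set ZFSet.{u})) : Prop where
  isRegular : κ.IsRegular
  continuum_lt : Cardinal.continuum < κ
  isWellOrder : IsWellOrder (H κ) r
  strictMono : ∀ α < Ordinal.omega.{u} 1, StrictMono (f α)
  subset_sub : S ⊆ Sub κ r
  stationary : IsStationary (H κ) S
  seq_mem : ∀ M ∈ S, seqCode f ∈ M
  /-- The main clause; the sequence `M` is `δ`-increasing. -/
  holds : ∀ (n : ℕ) (M : Fin (n + 1) → Set ZFSet.{u}), (∀ i, M i ∈ S) →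
    Monotone (fun i => height (M i)) →
    ∀ R : Set ((Fin (n + 1) → ℕ → ℕ) × (ℕ → ℕ)), IsProjective R → IsAdequate R →
      relCode R ∈ M (Fin.last n) →
      ∀ x : Fin (n + 1) → ℕ → ℕ, (∀ i, realCode (x i) ∈ M i) →
        (x, f (height (M (Fin.last n)))) ∈ R

/-! ### Strong P-points -/

/-- Compactness of a family of subsets of `ω` in the topology of the Cantor space `2^ω`, where
sets are identified with their characteristic functions. -/
def IsCompactFamily (C : Set (Set ℕ)) : Prop :=
  IsCompact {χ : ℕ → Bool | {n | χ n = true} ∈ C}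

/-- `P` is a partition of `ω` into (nonempty, finite, consecutive) intervals. -/
def IsIntervalPartition (P : ℕ → Set ℕ) : Prop :=
  ∃ k : ℕ → ℕ, StrictMono k ∧ k 0 = 0 ∧ ∀ n, P n = Set.Ico (k n) (k (n + 1))

/-- Strong P-points. All ultrafilters are required to be non-principal. -/
def IsStrongPPoint (U : Ultrafilter ℕ) : Prop :=
  (U : Filter ℕ) ≤ Filter.cofinite ∧
  ∀ C : ℕ → Set (Set ℕ), (∀ n, IsCompactFamily (C n) ∧ ∀ A ∈ C n, A ∈ U) →
    ∃ P : ℕ → Set ℕ, IsIntervalPartition P ∧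
      ∀ A : Set ℕ, (∀ n, ∃ X ∈ C n, A ∩ P n = X ∩ P n) → A ∈ U

end DPathway

/-!
A sequence `C = ⟨C_n⟩` of compact families and an increasing function `g` give the family
`patch C g` of all sets that agree, on the `t`-th interval of the partition with endpoints
`k_{t+1} = g(k_t) + 1`, with a member of `C_t`. The strong P-point is generated by families
`patch C f_γ`, where `C` is coded by a real in a model of `S` of height exactly `γ`. At stage `γ` a
maximal set `chosen γ` of such sequences is taken, subject to the condition that the members of
the families `C_n`, for the chosen `C`, form together with all earlier generators a family with
infinite finite intersections (`Centered`).

*The generators stay centered* (`IsMultiplePathway.centered_generators`). Consider finitely many of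
them, with heights `γ_0 ≤ ⋯ ≤ γ_n`; those of height `γ_n` are called new, the others old. The choice
of `chosen γ_n` and compactness (`compatible_of_approximates`) bound, for each `m`, how far beyond
`m` a common point has to be sought, uniformly over all members of the old families `patch C f_{γ_i}`
and all members of the `C_m` of the new sequences. If the partition given by `g` has only finitely
many intervals exceeding these bounds, then `g` is dominated by their iterates
(`Compatible.exists_meetsOften`). So "if the given generators are compatible, then they remain so when
the new ones are patched along `g`" is a `≤*`-adequate relation `stageRel`. It is Borel, because
compact families are coded by their finite approximations. The pathway yields it for `g = f_{γ_n}`,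
provided that it belongs to the last model. Its parameters are the functions `f_{γ_i}` of the old
generators, and the ordinals `γ_i < γ_n` belong to that model. Hence it is enough to use
only those models `M ∈ S` that are closed under the map from finite sequences of ordinals to the
codes of the relations attached to them. As these codes lie in `H(κ)`, by `𝔠 < κ`, the sets so closed
form a club (`isClub_isClosedUnder`), and by stationarity every real belongs to such a model.

*The ultrafilter is a strong P-point* (`IsMultiplePathway.exists_isStrongPPoint`). Let `U` be a
nonprincipal ultrafilter containing all generators, and let `C_n ⊆ U` for all `n`, where `C` is coded
in a model of height `γ`. Every set that was required to be centered at stage `γ` belongs to `U`, and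
so do the members of the `C_n`. By maximality `C` was chosen at stage `γ`, so `patch C f_γ ⊆ U`.
-/

namespace DPathway

section Combinatorics

open Filter

/-! ### Finite approximations of sequences of compact families -/

/-- The finite set `X ∩ k`. -/
noncomputable def cut (X : Set ℕ) (k : ℕ) : Finset ℕ :=
  open Classical in (Finset.range k).filter (· ∈ X)

theorem mem_cut {X : Set ℕ} {k j : ℕ} : j ∈ cut X k ↔ j < k ∧ j ∈ X := by
  simp [cut]

/-- Finite approximations of a sequence `⟨C_n⟩` of families of subsets of `ω`: `d n k F` says
that `F` is an admissible candidate for `X ∩ k` with `X ∈ C_n`. -/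
abbrev Levels : Type := ℕ → ℕ → Finset ℕ → Prop

/-- The approximations of a given sequence of families: the traces `X ∩ k` with `X ∈ C_n`. -/
def seqLevels (C : ℕ → Set (Set ℕ)) : Levels :=
  fun n k F => ∃ X ∈ C n, F = cut X k

/-- The endpoints `0 = k₀ < k₁ < ⋯` with `k_{t+1} = g(k_t) + 1` of the interval partition
given by an increasing function `g`. -/
def endpoint (g : ℕ → ℕ) : ℕ → ℕ
  | 0 => 0
  | t + 1 => g (endpoint g t) + 1

/-- The sets that agree on the `t`-th interval of the partition given by `g` with an
approximation of a member of the `t`-th family, for every `t`. -/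
def patch (d : Levels) (g : ℕ → ℕ) : Set (Set ℕ) :=
  {A | ∀ t, ∃ F, d t (endpoint g (t + 1)) F ∧
    ∀ j, endpoint g t ≤ j → j < endpoint g (t + 1) → (j ∈ A ↔ j ∈ F)}

/-- Approximations of the compact family `patch d h`, regarded as a constant sequence. -/
def patchLevels (d : Levels) (h : ℕ → ℕ) : Levels :=
  fun _ k F => ∀ t, endpoint h (t + 1) ≤ k → ∃ F', d t (endpoint h (t + 1)) F' ∧
    ∀ j, endpoint h t ≤ j → j < endpoint h (t + 1) → (j ∈ F ↔ j ∈ F')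

/-- In the limit, members of the approximated families have infinite intersections: for all `n`
and `m`, any choice of approximations of high enough level `k` has a common point in `[m, k)`. -/
def Compatible {ι : Type} (d : ι → Levels) : Prop :=
  ∀ n m, ∃ k₀, ∀ k, k₀ ≤ k → ∀ F : ι → Finset ℕ, (∀ i, d i n k (F i)) →
    ∃ j, m ≤ j ∧ j < k ∧ ∀ i, j ∈ F i

/-- For infinitely many `t`, any choice of approximations of the `t`-th families has a common
point in the `t`-th interval of the partition given by `g`. -/
def MeetsOften {ι : Type} (d : ι → Levels) (g : ℕ → ℕ) : Prop :=
  ∀ N, ∃ t, N ≤ t ∧ ∀ F : ι → Finset ℕ, (∀ i, d i t (endpoint g (t + 1)) (F i)) →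
    ∃ j, endpoint g t ≤ j ∧ j < endpoint g (t + 1) ∧ ∀ i, j ∈ F i

theorem endpoint_strictMono {g : ℕ → ℕ} (hg : StrictMono g) : StrictMono (endpoint g) :=
  strictMono_nat_of_lt_succ fun t => Nat.lt_succ_of_le (hg.id_le (endpoint g t))

theorem mem_patch_seqLevels {C : ℕ → Set (Set ℕ)} {g : ℕ → ℕ} {A : Set ℕ} :
    A ∈ patch (seqLevels C) g ↔ ∀ t, ∃ X ∈ C t,
      ∀ j, endpoint g t ≤ j → j < endpoint g (t + 1) → (j ∈ A ↔ j ∈ X) := by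
  refine forall_congr' fun t => ⟨?_, ?_⟩
  · rintro ⟨_, ⟨X, hX, rfl⟩, h⟩
    exact ⟨X, hX, fun j h₁ h₂ => (h j h₁ h₂).trans (by simp [mem_cut, h₂])⟩
  · rintro ⟨X, hX, h⟩
    exact ⟨_, ⟨X, hX, rfl⟩, fun j h₁ h₂ => (h j h₁ h₂).trans (by simp [mem_cut, h₂])⟩

/-- Once a patched family is regarded as a constant sequence, patching it along any other
partition loses none of its members. -/
theorem patch_subset_patch_patchLevels (d : Levels) (h : ℕ → ℕ) {g : ℕ → ℕ} :
    patch d h ⊆ patch (patchLevels d h) g := by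
  intro A hA t
  refine ⟨cut A (endpoint g (t + 1)), fun s hs => ?_, fun j _ h₂ => by simp [mem_cut, h₂]⟩
  obtain ⟨F, hF, hAF⟩ := hA s
  refine ⟨F, hF, fun j h₁ h₂ => ?_⟩
  rw [mem_cut, ← hAF j h₁ h₂]
  exact and_iff_right (h₂.trans_le hs)

theorem MeetsOften.infinite_iInter {ι : Type} {d : ι → Levels} {g : ℕ → ℕ} (hg : StrictMono g)
    (h : MeetsOften d g) {A : ι → Set ℕ} (hA : ∀ i, A i ∈ patch (d i) g) :
    (⋂ i, A i).Infinite := by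
  refine Set.infinite_of_forall_exists_gt fun N => ?_
  obtain ⟨t, ht, h⟩ := h (N + 1)
  choose F hF hAF using fun i => hA i t
  obtain ⟨j, h₁, h₂, hj⟩ := h F hF
  exact ⟨j, Set.mem_iInter.2 fun i => (hAF i j h₁ h₂).2 (hj i),
    Nat.lt_of_succ_le (ht.trans (((endpoint_strictMono hg).id_le t).trans h₁))⟩

/-! ### Compactness -/

/-- `L n` contains all limits of approximations in `d n`. -/
def Approximates (d : Levels) (L : ℕ → Set (Set ℕ)) : Prop :=
  ∀ n X, (∀ m, ∃ k, m ≤ k ∧ ∃ F, d n k F ∧ ∀ j < m, (j ∈ F ↔ j ∈ X)) → X ∈ L n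

theorem compatible_of_approximates {ι : Type} [Finite ι] {d : ι → Levels}
    {L : ι → ℕ → Set (Set ℕ)} (hd : ∀ i, Approximates (d i) (L i))
    (hL : ∀ n (X : ι → Set ℕ), (∀ i, X i ∈ L i n) → (⋂ i, X i).Infinite) :
    Compatible d := by
  intro n m
  by_contra! hcon
  choose k hk F hF hbad using hcon
  -- A counterexample at every level has a limit along a nonprincipal ultrafilter.
  let 𝒱 : Ultrafilter ℕ := hyperfilter ℕ
  have hlarge : ∀ b, ∀ᶠ s in (𝒱 : Filter ℕ), b ≤ s := fun b =>
    Nat.hyperfilter_le_atTop (eventually_ge_atTop b)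
  let X : ι → Set ℕ := fun i => {j | ∀ᶠ s in (𝒱 : Filter ℕ), j ∈ F s i}
  have hlim : ∀ i j, ∀ᶠ s in (𝒱 : Filter ℕ), (j ∈ F s i ↔ j ∈ X i) := by
    intro i j
    by_cases hj : j ∈ X i
    · filter_upwards [show ∀ᶠ s in (𝒱 : Filter ℕ), j ∈ F s i from hj] with s hs
      simp [hs, hj]
    · filter_upwards [Ultrafilter.eventually_not.2 hj] with s hs
      simp [hs, hj]
  have hX : ∀ i, X i ∈ L i n := by
    intro i
    refine hd i n _ fun b => ?_
    have h₁ : ∀ᶠ s in (𝒱 : Filter ℕ), ∀ j ∈ Finset.range b, (j ∈ F s i ↔ j ∈ X i) :=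
      (Finset.eventually_all _).2 fun j _ => hlim i j
    obtain ⟨s, hs, hbs⟩ := (h₁.and (hlarge b)).exists
    exact ⟨k s, hbs.trans (hk s), F s i, hF s i, fun j hj => hs j (Finset.mem_range.2 hj)⟩
  obtain ⟨j, hj, hmj⟩ := (hL n X hX).exists_gt m
  have h₁ : ∀ᶠ s in (𝒱 : Filter ℕ), ∀ i, j ∈ F s i :=
    eventually_all.2 fun i => Set.mem_iInter.1 hj i
  obtain ⟨s, hs, hjs⟩ := (h₁.and (hlarge (j + 1))).exists
  obtain ⟨i, hi⟩ := hbad s j hmj.le (hjs.trans (hk s))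
  exact hi (hs i)

theorem approximates_seqLevels {C : ℕ → Set (Set ℕ)} (hC : ∀ n, IsCompactFamily (C n)) :
    Approximates (seqLevels C) C := by
  classical
  intro n X hX
  have hcl := (hC n).isClosed
  have key : (fun j => decide (j ∈ X)) ∈ {χ : ℕ → Bool | {j | χ j = true} ∈ C n} := by
    rw [← hcl.closure_eq, mem_closure_iff_nhds]
    intro V hV
    rw [nhds_pi, Filter.mem_pi] at hV
    obtain ⟨I, hI, t, ht, htV⟩ := hV
    obtain ⟨b, hb⟩ := hI.bddAbove
    obtain ⟨k, hk, _, ⟨Y, hY, rfl⟩, hYX⟩ := hX (b + 1)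
    refine ⟨fun j => decide (j ∈ Y), htV fun j hj => ?_, by simpa using hY⟩
    have hjb : j < b + 1 := Nat.lt_succ_of_le (hb hj)
    have : j ∈ Y ↔ j ∈ X := by
      rw [← hYX j hjb, mem_cut]
      exact (and_iff_right (hjb.trans_le hk)).symm
    simpa only [this] using mem_of_mem_nhds (ht j)
  simpa using key

theorem approximates_patchLevels (d : Levels) (h : ℕ → ℕ) :
    Approximates (patchLevels d h) fun _ => patch d h := by
  intro n X hX t
  obtain ⟨k, hk, F, hF, hFX⟩ := hX (endpoint h (t + 1))
  obtain ⟨F', hF', hFF'⟩ := hF t hk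
  exact ⟨F', hF', fun j h₁ h₂ => (hFX j h₂).symm.trans (hFF' j h₁ h₂)⟩

/-! ### Adequacy -/

theorem iterate_le_iterate_of_id_le {b : ℕ → ℕ} (hb : Monotone b) (hid : ∀ m, m ≤ b m)
    {r s x y : ℕ} (hrs : r ≤ s) (hxy : x ≤ y) : b^[r] x ≤ b^[s] y :=
  (hb.iterate r hxy).trans (monotone_nat_of_le_succ (f := fun r => b^[r] y)
    (fun r => by simpa only [Function.iterate_succ_apply'] using hid _) hrs)

/-- If the partition given by `g` did not have infinitely many intervals long enough to be met,
then its endpoints, and with them `g`, would be bounded by the iterates of a function that depends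
on `d` only. -/
theorem Compatible.exists_meetsOften {ι : Type} {d : ι → Levels} (hd : Compatible d) :
    ∃ f : ℕ → ℕ, ∀ g : ℕ → ℕ, StrictMono g → ¬ g ≤ᶠ[atTop] f → MeetsOften d g := by
  choose k₀ hk₀ using hd
  -- A monotone function such that every level `k ≥ b m` suffices for all `n ≤ m`.
  let b : ℕ → ℕ := fun m => m + ∑ n ∈ Finset.range (m + 1), ∑ p ∈ Finset.range (m + 1), k₀ n p
  have hid : ∀ m, m ≤ b m := fun m => Nat.le_add_right _ _
  have hb : Monotone b := by
    intro m m' hm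
    have hs : Finset.range (m + 1) ⊆ Finset.range (m' + 1) :=
      Finset.range_mono (Nat.succ_le_succ hm)
    exact add_le_add hm ((Finset.sum_le_sum fun n _ => Finset.sum_le_sum_of_subset hs).trans
      (Finset.sum_le_sum_of_subset hs))
  have hk₀b : ∀ n m, n ≤ m → k₀ n m ≤ b m := by
    intro n m hnm
    have h₁ : k₀ n m ≤ ∑ p ∈ Finset.range (m + 1), k₀ n p :=
      Finset.single_le_sum (f := fun p => k₀ n p) (fun _ _ => Nat.zero_le _) (by simp)
    have h₂ : ∑ p ∈ Finset.range (m + 1), k₀ n p ≤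
        ∑ n ∈ Finset.range (m + 1), ∑ p ∈ Finset.range (m + 1), k₀ n p :=
      Finset.single_le_sum (f := fun n => ∑ p ∈ Finset.range (m + 1), k₀ n p)
        (fun _ _ => Nat.zero_le _) (by simpa using Nat.lt_succ_of_le hnm)
    exact (h₁.trans h₂).trans (Nat.le_add_left _ _)
  refine ⟨fun t => b^[t + 1] (t + 1), fun g hg hgf => ?_⟩
  by_contra hcon
  obtain ⟨N, hN⟩ := not_forall.1 hcon
  rw [not_exists] at hN
  have hmono := endpoint_strictMono hg
  have hstep : ∀ t, N ≤ t → endpoint g (t + 1) ≤ b (endpoint g t) := by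
    intro t ht
    by_contra! hlt
    refine hN t ⟨ht, fun F hF => ?_⟩
    exact hk₀ t (endpoint g t) _ ((hk₀b _ _ (hmono.id_le t)).trans hlt.le) F hF
  have hiter : ∀ s, endpoint g (N + s) ≤ b^[s] (endpoint g N) := by
    intro s
    induction s with
    | zero => simp
    | succ s ih =>
      rw [Function.iterate_succ_apply']
      exact (hstep (N + s) (Nat.le_add_right _ _)).trans (hb ih)
  refine hgf ?_
  filter_upwards [eventually_ge_atTop (N + endpoint g N)] with t ht
  obtain ⟨s, rfl⟩ : ∃ s, t = N + s := ⟨t - N, by omega⟩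
  have h₁ : g (N + s) ≤ endpoint g (N + s + 1) :=
    (hg.monotone (hmono.id_le (N + s))).trans (Nat.le_succ _)
  exact (h₁.trans (hiter (s + 1))).trans
    (iterate_le_iterate_of_id_le hb hid (by omega) (by omega))

/-! ### The relations to which a pathway is applied -/

/-- The approximations coded by a function `x : ω → ω`. -/
def decode (x : ℕ → ℕ) : Levels := fun n k F => x (Encodable.encode (n, k, F)) = 1

theorem exists_decode_eq (d : Levels) : ∃ x, decode x = d := by
  classical
  refine ⟨fun c => if ∃ n k F, Encodable.encode (n, k, F) = c ∧ d n k F then 1 else 0, ?_⟩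
  ext n k F
  simp [decode]

/-- The approximations of a new generator (`none`) are those of the sequence itself; those of an
old generator are those of the family that was patched along the partition given by `h`. -/
def stageLevels : Option (ℕ → ℕ) → Levels → Levels
  | none, d => d
  | some h, d => patchLevels d h

/-- The relation `R(x₀, …, x_n, g)` stating that, if the generators coded by the `x_i` are
compatible, then they stay so when the new ones are patched along the partition given by `g`. -/
def stageRel {n : ℕ} (a : Fin (n + 1) → Option (ℕ → ℕ)) :
    Set ((Fin (n + 1) → ℕ → ℕ) × (ℕ → ℕ)) :=
  {p | Compatible (fun i => stageLevels (a i) (decode (p.1 i))) →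
    MeetsOften (fun i => stageLevels (a i) (decode (p.1 i))) p.2}

theorem isAdequate_stageRel {n : ℕ} (a : Fin (n + 1) → Option (ℕ → ℕ)) :
    IsAdequate (stageRel a) := by
  intro x
  by_cases hx : Compatible (fun i => stageLevels (a i) (decode (x i)))
  · obtain ⟨f, hf⟩ := hx.exists_meetsOften
    exact ⟨f, fun g hg hgf _ => hf g hg hgf⟩
  · exact ⟨0, fun g _ _ h => absurd h hx⟩

theorem measurable_endpoint (t : ℕ) : Measurable fun g : ℕ → ℕ => endpoint g t := by
  induction t with
  | zero => exact measurable_const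
  | succ t ih =>
    have : Measurable fun p : ℕ × (ℕ → ℕ) => p.2 p.1 :=
      measurable_from_prod_countable_right fun m => measurable_pi_apply m
    exact (Measurable.of_discrete (f := Nat.succ)).comp (this.comp (ih.prodMk measurable_id))

theorem measurable_stageLevels {α : Type} [MeasurableSpace α] (a : Option (ℕ → ℕ))
    {x : α → ℕ → ℕ} (hx : Measurable x) (n k : ℕ) (F : Finset ℕ) :
    Measurable fun p => stageLevels a (decode (x p)) n k F := by
  have h₀ : ∀ n k F, Measurable fun p => decode (x p) n k F := fun n k F =>
    (measurable_pi_iff.1 hx _).eq_const 1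
  cases a with
  | none => exact h₀ n k F
  | some h =>
    refine Measurable.forall fun t => Measurable.imp measurable_const ?_
    exact Measurable.exists fun F' => (h₀ _ _ _).and measurable_const

theorem isProjective_stageRel {n : ℕ} (a : Fin (n + 1) → Option (ℕ → ℕ)) :
    IsProjective (stageRel a) := by
  have : SecondCountableTopology (Fin (n + 1) → ℕ → ℕ) := inferInstance
  have : BorelSpace ((Fin (n + 1) → ℕ → ℕ) × (ℕ → ℕ)) := Prod.borelSpace
  have : PolishSpace ((Fin (n + 1) → ℕ → ℕ) × (ℕ → ℕ)) := {}
  refine ⟨0, MeasurableSet.analyticSet (measurableSet_setOfPred.2 ?_)⟩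
  have hd : ∀ i n' k F, Measurable fun p : (Fin (n + 1) → ℕ → ℕ) × (ℕ → ℕ) =>
      stageLevels (a i) (decode (p.1 i)) n' k F := fun i =>
    measurable_stageLevels (a i) ((measurable_pi_apply i).comp measurable_fst)
  have he : ∀ t, Measurable fun p : (Fin (n + 1) → ℕ → ℕ) × (ℕ → ℕ) => endpoint p.2 t :=
    fun t => (measurable_endpoint t).comp measurable_snd
  refine Measurable.imp ?_ ?_
  · refine Measurable.forall fun n' => Measurable.forall fun m => Measurable.exists fun k₀ =>
      Measurable.forall fun k => measurable_const.imp (Measurable.forall fun F =>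
        Measurable.imp (Measurable.forall fun i => hd i n' k (F i)) measurable_const)
  · refine Measurable.forall fun N => Measurable.exists fun t => measurable_const.and
      (Measurable.forall fun F => Measurable.imp (Measurable.forall fun i => ?_)
        (Measurable.exists fun j => ?_))
    · have : Measurable fun p : (Fin (n + 1) → ℕ → ℕ) × (ℕ → ℕ) =>
          ∃ k, endpoint p.2 (t + 1) = k ∧ stageLevels (a i) (decode (p.1 i)) t k (F i) :=
        Measurable.exists fun k => ((he (t + 1)).eq_const k).and (hd i t k (F i))
      simpa using this
    · exact (((Measurable.of_discrete (f := fun s => s ≤ j)).comp (he t))).and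
        ((((Measurable.of_discrete (f := fun s => j < s)).comp (he (t + 1)))).and measurable_const)

end Combinatorics

section Models

open Cardinal

/-! ### Clubs of sets that are closed under a finitary operation -/

/-- `N` is closed under the operation `G` on nonempty finite sequences, in which the entry `none`
stands for an omitted argument. -/
def IsClosedUnder {α : Type*} (G : ∀ n, (Fin (n + 1) → Option α) → α) (N : Set α) : Prop :=
  ∀ n (l : Fin (n + 1) → Option α), (∀ i z, l i = some z → z ∈ N) → G n l ∈ N

theorem exists_entries_mem_of_iUnion {α : Type*} {N : ℕ → Set α} (hN : Monotone N) {n : ℕ}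
    {l : Fin (n + 1) → Option α} (hl : ∀ i z, l i = some z → z ∈ ⋃ k, N k) :
    ∃ k, ∀ i z, l i = some z → z ∈ N k := by
  have h : ∀ i, ∃ k, ∀ z, l i = some z → z ∈ N k := by
    intro i
    cases hi : l i with
    | none => exact ⟨0, by simp⟩
    | some z =>
      obtain ⟨k, hk⟩ := Set.mem_iUnion.1 (hl i z hi)
      exact ⟨k, by simpa using hk⟩
  choose k hk using h
  exact ⟨Finset.univ.sup k, fun i z hz => hN (Finset.le_sup (Finset.mem_univ i)) (hk i z hz)⟩

theorem isClub_isClosedUnder {α : Type*} {X : Set α} {G : ∀ n, (Fin (n + 1) → Option α) → α}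
    (hG : ∀ n l, G n l ∈ X) {x : α} (hx : x ∈ X) :
    IsClub X {N | (N ⊆ X ∧ N.Countable) ∧ x ∈ N ∧ IsClosedUnder G N} where
  countable_subset N hN := hN.1
  unbounded N₀ hN₀ hN₀c := by
    let step : Set α → Set α := fun N =>
      N ∪ ⋃ n, Set.range fun l : Fin (n + 1) → Option N => G n fun i => (l i).map Subtype.val
    let N : ℕ → Set α := fun k => step^[k] (insert x N₀)
    have hsucc : ∀ k, N (k + 1) = step (N k) := fun k => Function.iterate_succ_apply' _ _ _
    have hmono : Monotone N := monotone_nat_of_le_succ fun k => by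
      rw [hsucc]; exact Set.subset_union_left
    have hNX : ∀ k, N k ⊆ X ∧ (N k).Countable := by
      intro k
      induction k with
      | zero => exact ⟨Set.insert_subset hx hN₀, hN₀c.insert x⟩
      | succ k ih =>
        rw [hsucc]
        have := ih.2.to_subtype
        refine ⟨Set.union_subset ih.1 (Set.iUnion_subset fun n => ?_),
          ih.2.union (Set.countable_iUnion fun n => Set.countable_range _)⟩
        rintro _ ⟨l, rfl⟩
        exact hG _ _
    have h0 : insert x N₀ ⊆ ⋃ k, N k := Set.subset_iUnion N 0
    refine ⟨⋃ k, N k, ⟨⟨Set.iUnion_subset fun k => (hNX k).1,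
      Set.countable_iUnion fun k => (hNX k).2⟩, h0 (Set.mem_insert _ _), ?_⟩,
      (Set.subset_insert _ _).trans h0⟩
    intro n l hl
    obtain ⟨k, hk⟩ := exists_entries_mem_of_iUnion hmono hl
    refine Set.mem_iUnion.2 ⟨k + 1, ?_⟩
    rw [hsucc]
    refine Or.inr (Set.mem_iUnion.2 ⟨n, fun i => (l i).pmap Subtype.mk (hk i), ?_⟩)
    simp [Option.map_pmap]
  closed N hN h := by
    refine ⟨⟨Set.iUnion_subset fun k => (h k).1.1, Set.countable_iUnion fun k => (h k).1.2⟩,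
      Set.mem_iUnion.2 ⟨0, (h 0).2.1⟩, fun n l hl => ?_⟩
    obtain ⟨k, hk⟩ := exists_entries_mem_of_iUnion hN hl
    exact Set.mem_iUnion.2 ⟨k, (h k).2.2 n l hk⟩

/-! ### Sets whose transitive closure has size at most continuum -/

/-- The sets whose transitive closure has size at most `𝔠`. -/
def HSmall (x : ZFSet.{u}) : Prop :=
  #{y : ZFSet.{u} // Relation.TransGen (· ∈ ·) y x} ≤ 𝔠

theorem HSmall.mem_H {x : ZFSet.{u}} (hx : HSmall x) {κ : Cardinal.{u}} (hκ : 𝔠 < κ) :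
    x ∈ H κ := by
  refine lt_of_le_of_lt (b := 𝔠) hx ?_
  rwa [← lift_continuum.{u + 1, u}, lift_lt]

theorem HSmall.of_mem {x : ZFSet.{u}} (hx : #{y // y ∈ x} ≤ 𝔠) (h : ∀ y ∈ x, HSmall y) :
    HSmall x := by
  have heq : {y : ZFSet.{u} | Relation.TransGen (· ∈ ·) y x} =
      ⋃ z : {z // z ∈ x}, insert z.1 {y | Relation.TransGen (· ∈ ·) y z.1} := by
    ext y
    rw [Set.mem_ofPred_eq, Relation.TransGen.tail'_iff]
    simp only [Set.mem_iUnion, Set.mem_insert_iff, Subtype.exists, Set.mem_ofPred_eq,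
      Relation.reflTransGen_iff_eq_or_transGen, exists_prop]
    exact exists_congr fun z => and_comm.trans (and_congr_right fun _ => by rw [eq_comm])
  change #({y : ZFSet.{u} | Relation.TransGen (· ∈ ·) y x} : Set _) ≤ 𝔠
  rw [heq]
  refine (mk_iUnion_le _).trans ((mul_le_mul' hx (ciSup_le' fun z => ?_)).trans
    continuum_mul_self.le)
  refine (mk_insert_le).trans ?_
  exact add_le_of_le aleph0_le_continuum (h z.1 z.2) (one_le_aleph0.trans aleph0_le_continuum)

theorem HSmall.range {ι : Type} [Small.{u} ι] (hι : #ι ≤ 𝔠) {f : ι → ZFSet.{u}}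
    (h : ∀ i, HSmall (f i)) : HSmall (ZFSet.range f) := by
  refine HSmall.of_mem ?_ ?_
  · have : {y // y ∈ ZFSet.range f} = Set.range f := by
      simp only [ZFSet.mem_range]; rfl
    rw [this]
    have h₁ := mk_range_le_lift (f := f)
    have h₂ : lift.{u + 1} #ι ≤ lift.{u + 1} 𝔠 := lift_le.2 hι
    rw [lift_continuum] at h₂
    simpa using h₁.trans h₂
  · intro y hy
    obtain ⟨i, rfl⟩ := ZFSet.mem_range.1 hy
    exact h i

theorem HSmall.insert_singleton {x y : ZFSet.{u}} (hx : HSmall x) (hy : HSmall y) :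
    HSmall ({x, y} : ZFSet.{u}) := by
  have h : ({x, y} : ZFSet.{u}) = ZFSet.range fun b : Bool => cond b x y := by
    ext z; simp [eq_comm, or_comm]
  rw [h]
  refine HSmall.range.{u} ((mk_le_aleph0 (α := Bool)).trans aleph0_le_continuum) fun b => ?_
  cases b
  exacts [hy, hx]

theorem HSmall.pair {x y : ZFSet.{u}} (hx : HSmall x) (hy : HSmall y) :
    HSmall (ZFSet.pair x y) := by
  have h : HSmall ({x} : ZFSet.{u}) := by
    simpa using hx.insert_singleton hx
  exact h.insert_singleton (hx.insert_singleton hy)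

theorem hSmall_natCode (n : ℕ) : HSmall (natCode.{u} n) := by
  induction n using Nat.strong_induction_on with
  | _ n ih =>
    have h : natCode.{u} n = ZFSet.range fun i : Fin n => natCode.{u} i := by
      ext z
      simp only [natCode, Ordinal.mem_toZFSet_iff, ZFSet.mem_range]
      constructor
      · rintro ⟨a, ha, rfl⟩
        obtain ⟨m, rfl⟩ := Ordinal.lt_omega0.1 (ha.trans (Ordinal.natCast_lt_omega0 n))
        exact ⟨⟨m, by exact_mod_cast ha⟩, rfl⟩
      · rintro ⟨i, rfl⟩
        exact ⟨i, by exact_mod_cast i.2, rfl⟩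
    rw [h]
    exact HSmall.range.{u} (mk_le_aleph0.trans aleph0_le_continuum) fun i => ih i i.2

theorem hSmall_realCode (g : ℕ → ℕ) : HSmall (realCode.{u} g) :=
  HSmall.range.{u} (mk_le_aleph0.trans aleph0_le_continuum) fun _ =>
    (hSmall_natCode _).pair (hSmall_natCode _)

theorem hSmall_relCode {m : ℕ} (R : Set ((Fin m → ℕ → ℕ) × (ℕ → ℕ))) :
    HSmall (relCode.{u} R) := by
  unfold relCode
  refine HSmall.range.{u} ((mk_set_le R).trans ?_) fun p => HSmall.pair ?_ (hSmall_realCode _)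
  · have h₁ : #(ℕ → ℕ) = 𝔠 := by simp
    have h₂ : #(Fin m → ℕ → ℕ) ≤ 𝔠 := by
      rw [mk_pi, prod_const, h₁, lift_continuum, mk_fin]
      simpa using power_nat_le (n := m) aleph0_le_continuum
    rw [mk_prod, lift_id, lift_id, h₁]
    exact (mul_le_mul' h₂ le_rfl).trans continuum_mul_self.le
  · exact HSmall.range.{u} (mk_le_aleph0.trans aleph0_le_continuum) fun i =>
      (hSmall_natCode _).pair (hSmall_realCode _)

/-! ### Heights -/

theorem toZFSet_mem_of_lt_height {M : Set ZFSet.{u}} {α : Ordinal.{u}} (h : α < height M) :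
    Ordinal.toZFSet α ∈ M :=
  not_not.1 (notMem_of_lt_csInf' h)

theorem height_lt_omega_one {M : Set ZFSet.{u}} (hM : M.Countable) :
    height M < Ordinal.omega.{u} 1 := by
  by_contra! hle
  have hsub : Ordinal.toZFSet '' Set.Iio (Ordinal.omega.{u} 1) ⊆ M := by
    rintro _ ⟨α, hα, rfl⟩
    exact toZFSet_mem_of_lt_height (lt_of_lt_of_le hα hle)
  have hc : (Set.Iio (Ordinal.omega.{u} 1)).Countable :=
    Set.countable_of_injective_of_countable_image Ordinal.toZFSet_injective.injOn (hM.mono hsub)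
  have h := le_aleph0_iff_set_countable.2 hc
  rw [mk_Iio_ordinal, Ordinal.card_omega, ← lift_aleph0.{u + 1, u}, lift_le] at h
  exact absurd h (not_le.2 aleph0_lt_aleph_one)

end Models

open Filter

/-! ### Centered families -/

/-- All finite intersections are infinite. -/
def Centered (𝒜 : Set (Set ℕ)) : Prop :=
  ∀ s ⊆ 𝒜, s.Finite → (⋂₀ s).Infinite

theorem exists_fin_range_eq {α : Type*} {s : Set α} (hs : s.Finite) (hne : s.Nonempty) :
    ∃ (n : ℕ) (A : Fin (n + 1) → α), Set.range A = s := by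
  have := hs.fintype
  have := hne.to_subtype
  obtain ⟨n, hn⟩ := Nat.exists_eq_succ_of_ne_zero (Fintype.card_ne_zero (α := s))
  let e := (Fintype.equivFinOfCardEq hn).symm
  exact ⟨n, fun i => (e i).1, by rw [Set.range_comp' Subtype.val e]; simp⟩

theorem Centered.infinite_iInter {𝒜 : Set (Set ℕ)} (h : Centered 𝒜) {ι : Type} [Finite ι]
    {X : ι → Set ℕ} (hX : ∀ i, X i ∈ 𝒜) : (⋂ i, X i).Infinite := by
  rw [← Set.sInter_range]
  exact h _ (Set.range_subset_iff.2 hX) (Set.finite_range X)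

theorem Centered.exists_ultrafilter {𝒜 : Set (Set ℕ)} (h : Centered 𝒜) :
    ∃ U : Ultrafilter ℕ, (U : Filter ℕ) ≤ cofinite ∧ ∀ A ∈ 𝒜, A ∈ U := by
  have hne : (generate 𝒜 ⊓ cofinite).NeBot := by
    refine inf_neBot_iff.2 fun {A} hA {B} hB => ?_
    obtain ⟨s, hs, hfin, hsA⟩ := mem_generate_iff.1 hA
    obtain ⟨j, hj, hjB⟩ := ((h s hs hfin).sdiff (mem_cofinite.1 hB)).nonempty
    exact ⟨j, hsA hj, not_not.1 hjB⟩
  refine ⟨Ultrafilter.of (generate 𝒜 ⊓ cofinite),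
    (Ultrafilter.of_le _).trans inf_le_right, fun A hA => ?_⟩
  exact (Ultrafilter.of_le (generate 𝒜 ⊓ cofinite)) (mem_inf_of_left (mem_generate_of_mem hA))

/-- Sequences of compact families can be added one by one to a centered family until no other
member of `Adm` can be added. -/
theorem exists_maximal_centered {E : Set (Set ℕ)} (hE : Centered E)
    (Adm : Set (ℕ → Set (Set ℕ))) :
    ∃ D, Maximal (fun D => D ⊆ Adm ∧ Centered (E ∪ ⋃ C ∈ D, ⋃ n, C n)) D := by
  suffices h : ∃ D, ∅ ⊆ D ∧ Maximal
      (· ∈ {D : Set (ℕ → Set (Set ℕ)) | D ⊆ Adm ∧ Centered (E ∪ ⋃ C ∈ D, ⋃ n, C n)}) D from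
    let ⟨D, _, hD⟩ := h
    ⟨D, hD⟩
  refine zorn_subset_nonempty _ (fun c hc hchain hne => ?_) ∅
    ⟨Set.empty_subset _, by simpa using hE⟩
  refine ⟨⋃₀ c, ⟨Set.sUnion_subset fun D hD => (hc hD).1, fun s hs hfin => ?_⟩,
    fun D hD => Set.subset_sUnion_of_mem hD⟩
  have hdir : DirectedOn (fun D D' : Set (ℕ → Set (Set ℕ)) =>
      (E ∪ ⋃ C ∈ D, ⋃ n, C n) ⊆ E ∪ ⋃ C ∈ D', ⋃ n, C n) c :=
    hchain.directedOn.mono' fun D _ D' _ h =>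
      Set.union_subset_union_right _ (Set.biUnion_subset_biUnion_left h)
  have hs' : ((hfin.toFinset : Finset (Set ℕ)) : Set (Set ℕ)) ⊆
      ⋃ D ∈ c, (E ∪ ⋃ C ∈ D, ⋃ n, C n) := by
    rw [hfin.coe_toFinset]
    intro A hA
    rcases hs hA with hA | hA
    · obtain ⟨D, hD⟩ := hne
      exact Set.mem_biUnion hD (Or.inl hA)
    · obtain ⟨C, ⟨D, hD, hCD⟩, hAC⟩ := Set.mem_iUnion₂.1 hA
      exact Set.mem_biUnion hD (Or.inr (Set.mem_biUnion hCD hAC))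
  obtain ⟨D, hD, hsD⟩ := DirectedOn.exists_mem_subset_of_finset_subset_biUnion hne hdir hs'
  exact (hc hD).2 s (by simpa using hsD) hfin

/-! ### One step of the construction -/

/-- The code of the relation attached to a finite sequence, whose entries are the heights of the
old generators, and `none` for the new ones. An ordinal is recovered from its von Neumann set as
the rank. -/
noncomputable def stageCode (f : Ordinal.{u} → ℕ → ℕ) (n : ℕ)
    (l : Fin (n + 1) → Option ZFSet.{u}) : ZFSet.{u} :=
  relCode (stageRel fun i => (l i).map fun z => f z.rank)

/-- The models of a pathway that contain the relations attached to their own elements. -/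
def goodModels (f : Ordinal.{u} → ℕ → ℕ) (S : Set (Set ZFSet.{u})) : Set (Set ZFSet.{u}) :=
  {M ∈ S | IsClosedUnder (stageCode f) M}

section Pathway

variable {κ : Cardinal.{u}} {r : H κ → H κ → Prop} {f : Ordinal.{u} → ℕ → ℕ}
  {S : Set (Set ZFSet.{u})}

theorem IsMultiplePathway.exists_goodModel (hp : IsMultiplePathway κ r f S) (x : ℕ → ℕ) :
    ∃ M ∈ goodModels f S, realCode x ∈ M := by
  obtain ⟨M, hMS, -, hx, hM⟩ := hp.stationary _ (isClub_isClosedUnder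
    (fun n l => (hSmall_relCode _).mem_H hp.continuum_lt : ∀ n l, stageCode f n l ∈ H κ)
    ((hSmall_realCode x).mem_H hp.continuum_lt))
  exact ⟨M, ⟨hMS, hM⟩, hx⟩

theorem IsMultiplePathway.height_lt (hp : IsMultiplePathway κ r f S) {M : Set ZFSet.{u}}
    (hM : M ∈ goodModels f S) : height M < Ordinal.omega.{u} 1 :=
  height_lt_omega_one (hp.subset_sub hM.1).1

/-- The main clause of a pathway, applied to generators listed by increasing height. Those of
top height are new, the others are old. -/
theorem IsMultiplePathway.infinite_iInter (hp : IsMultiplePathway κ r f S) {n : ℕ}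
    {M : Fin (n + 1) → Set ZFSet.{u}} (hM : ∀ i, M i ∈ goodModels f S)
    (hmono : Monotone fun i => height (M i)) {x : Fin (n + 1) → ℕ → ℕ}
    (hx : ∀ i, realCode (x i) ∈ M i) {C : Fin (n + 1) → ℕ → Set (Set ℕ)}
    (hC : ∀ i n, IsCompactFamily (C i n)) (hxC : ∀ i, decode (x i) = seqLevels (C i))
    (hcomp : ∀ X : Fin (n + 1) → Set ℕ,
      (∀ i, height (M i) < height (M (Fin.last n)) →
        X i ∈ patch (seqLevels (C i)) (f (height (M i)))) →
      (∀ i, height (M i) = height (M (Fin.last n)) → ∃ m, X i ∈ C i m) →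
      (⋂ i, X i).Infinite)
    {A : Fin (n + 1) → Set ℕ} (hA : ∀ i, A i ∈ patch (seqLevels (C i)) (f (height (M i)))) :
    (⋂ i, A i).Infinite := by
  classical
  set γ := height (M (Fin.last n)) with hγ
  -- The parameters of the relation are the heights of the old generators, which are elements of
  -- the last model because they are smaller than its height.
  let l : Fin (n + 1) → Option ZFSet.{u} := fun i =>
    if height (M i) < γ then some (Ordinal.toZFSet (height (M i))) else none
  let a : Fin (n + 1) → Option (ℕ → ℕ) := fun i => (l i).map fun z => f z.rank
  have ha_old : ∀ i, height (M i) < γ → a i = some (f (height (M i))) := by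
    intro i hi; simp [a, l, hi]
  have ha_new : ∀ i, ¬ height (M i) < γ → a i = none := by
    intro i hi; simp [a, l, hi]
  have htop : ∀ i, ¬ height (M i) < γ → height (M i) = γ := fun i hi =>
    le_antisymm (hmono (Fin.le_last i)) (not_lt.1 hi)
  have hcode : relCode (stageRel a) ∈ M (Fin.last n) := by
    refine (hM (Fin.last n)).2 n l fun i z hz => ?_
    by_cases hi : height (M i) < γ
    · obtain rfl : Ordinal.toZFSet (height (M i)) = z := by simpa [l, hi] using hz
      exact toZFSet_mem_of_lt_height hi
    · simp [l, hi] at hz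
  have hrel := hp.holds n M (fun i => (hM i).1) hmono _ (isProjective_stageRel a)
    (isAdequate_stageRel a) hcode x hx
  let L : Fin (n + 1) → ℕ → Set (Set ℕ) := fun i =>
    if height (M i) < γ then fun _ => patch (seqLevels (C i)) (f (height (M i))) else C i
  have hmeets : MeetsOften (fun i => stageLevels (a i) (decode (x i))) (f γ) := by
    refine hrel (compatible_of_approximates (L := L) (fun i => ?_) fun m X hX => ?_)
    · dsimp only [L]
      rw [hxC]
      split_ifs with hi
      · rw [ha_old i hi]
        exact approximates_patchLevels _ _
      · rw [ha_new i hi]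
        exact approximates_seqLevels (hC i)
    · refine hcomp X (fun i hi => ?_) fun i hi => ⟨m, ?_⟩
      · simpa [L, hi] using hX i
      · simpa [L, hi.not_lt] using hX i
  refine hmeets.infinite_iInter (hp.strictMono _ (hp.height_lt (hM (Fin.last n)))) fun i => ?_
  rw [hxC]
  by_cases hi : height (M i) < γ
  · rw [ha_old i hi]
    exact patch_subset_patch_patchLevels _ _ (hA i)
  · rw [ha_new i hi]
    have := hA i
    rwa [htop i hi] at this

/-! ### The construction by recursion on the height -/

/-- The sequences of compact families considered at stage `γ`: those coded in a model of height
`γ`. It is harmless to consider increasing sequences with `ω ∈ C₀` only. -/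
def admissible (f : Ordinal.{u} → ℕ → ℕ) (S : Set (Set ZFSet.{u})) (γ : Ordinal.{u}) :
    Set (ℕ → Set (Set ℕ)) :=
  {C | (∀ n, IsCompactFamily (C n)) ∧ Monotone C ∧ Set.univ ∈ C 0 ∧
    ∃ M ∈ goodModels f S, height M = γ ∧ ∃ x, decode x = seqLevels C ∧ realCode x ∈ M}

/-- The sequences chosen at stage `γ`: a maximal set of admissible sequences whose members are
centered together with the generators from the earlier stages. -/
noncomputable def chosen (f : Ordinal.{u} → ℕ → ℕ) (S : Set (Set ZFSet.{u}))
    (γ : Ordinal.{u}) : Set (ℕ → Set (Set ℕ)) :=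
  Classical.epsilon fun D => Maximal (fun D => D ⊆ admissible f S γ ∧
    Centered ((⋃ β : Set.Iio γ, ⋃ C ∈ chosen f S β.1, patch (seqLevels C) (f β.1)) ∪
      ⋃ C ∈ D, ⋃ n, C n)) D
termination_by γ
decreasing_by exact β.2

/-- The generators of the ultrafilter that come from the stages below `γ`. -/
def generators (f : Ordinal.{u} → ℕ → ℕ) (S : Set (Set ZFSet.{u})) (γ : Ordinal.{u}) :
    Set (Set ℕ) :=
  ⋃ β : Set.Iio γ, ⋃ C ∈ chosen f S β.1, patch (seqLevels C) (f β.1)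

theorem mem_generators {γ : Ordinal.{u}} {A : Set ℕ} :
    A ∈ generators f S γ ↔ ∃ β < γ, ∃ C ∈ chosen f S β, A ∈ patch (seqLevels C) (f β) := by
  simp [generators]

theorem maximal_chosen {γ : Ordinal.{u}} (h : Centered (generators f S γ)) :
    Maximal (fun D => D ⊆ admissible f S γ ∧
      Centered (generators f S γ ∪ ⋃ C ∈ D, ⋃ n, C n)) (chosen f S γ) := by
  have := Classical.epsilon_spec (exists_maximal_centered h (admissible f S γ))
  rw [chosen]
  exact this

theorem IsMultiplePathway.centered_generators (hp : IsMultiplePathway κ r f S)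
    (γ : Ordinal.{u}) : Centered (generators f S γ) := by
  induction γ using WellFoundedLT.induction with
  | _ γ ih =>
  intro s hs hfin
  obtain rfl | hne := s.eq_empty_or_nonempty
  · simpa using Set.infinite_univ
  obtain ⟨n, A₀, rfl⟩ := exists_fin_range_eq hfin hne
  choose β₀ hβ₀ C₀ hC₀ hA₀ using fun i => mem_generators.1 (hs (Set.mem_range_self i))
  -- The main clause of a pathway needs the generators listed by increasing height.
  let σ := Tuple.sort β₀
  have hmono : Monotone (β₀ ∘ σ) := Tuple.monotone_sort β₀
  have hadm : ∀ i, C₀ (σ i) ∈ admissible f S (β₀ (σ i)) := fun i =>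
    (maximal_chosen (ih _ (hβ₀ _))).prop.1 (hC₀ _)
  choose hC _ _ M hM hMβ x hx hxM using hadm
  have hlast := (maximal_chosen (ih _ (hβ₀ (σ (Fin.last n))))).prop.2
  have hinf : (⋂ i, A₀ (σ i)).Infinite := by
    refine hp.infinite_iInter hM ?_ hxM hC hx (fun X hold hnew => ?_)
      fun i => by rw [hMβ]; exact hA₀ _
    · simpa only [hMβ] using! hmono
    · refine hlast.infinite_iInter fun i => ?_
      simp only [hMβ] at hold hnew
      obtain hi | hi := (hmono (Fin.le_last i)).lt_or_eq
      · exact Or.inl (mem_generators.2 ⟨_, hi, _, hC₀ _, hold i hi⟩)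
      · have hi' : β₀ (σ i) = β₀ (σ (Fin.last n)) := hi
        exact Or.inr (Set.mem_biUnion (hi' ▸ hC₀ (σ i)) (Set.mem_iUnion.2 (hnew i hi)))
  rw [Set.sInter_range]
  rwa [σ.surjective.iInter_comp A₀] at hinf

/-- Up to finitely many points, a member of a family in an admissible sequence agrees with a
patched set. So it belongs to every nonprincipal ultrafilter that contains the patched sets. -/
theorem mem_of_mem_admissible (U : Ultrafilter ℕ) (hU : (U : Filter ℕ) ≤ cofinite)
    {γ : Ordinal.{u}} (hγ : StrictMono (f γ)) {C : ℕ → Set (Set ℕ)} (hC : C ∈ admissible f S γ)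
    (hCU : ∀ A ∈ patch (seqLevels C) (f γ), A ∈ U) {m : ℕ} {X : Set ℕ} (hX : X ∈ C m) :
    X ∈ U := by
  obtain ⟨-, hmono, huniv, -⟩ := hC
  have hA : Set.Iio (endpoint (f γ) m) ∪ X ∈ U := by
    refine hCU _ (mem_patch_seqLevels.2 fun t => ?_)
    obtain ht | ht := lt_or_ge t m
    · refine ⟨Set.univ, hmono (Nat.zero_le t) huniv, fun j _ hj => iff_of_true (Or.inl ?_) trivial⟩
      exact hj.trans_le ((endpoint_strictMono hγ).monotone ht)
    · refine ⟨X, hmono ht hX, fun j hj _ => or_iff_right fun hlt => hj.not_gt (lt_of_lt_of_le hlt ?_)⟩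
      exact (endpoint_strictMono hγ).monotone ht
  refine ((Ultrafilter.union_mem_iff).1 hA).resolve_left fun h => ?_
  exact Ultrafilter.compl_notMem_iff.2 h (hU (Set.finite_Iio _).compl_mem_cofinite)

theorem isCompactFamily_univ : IsCompactFamily {Set.univ} := by
  have : {χ : ℕ → Bool | {n | χ n = true} ∈ ({Set.univ} : Set (Set ℕ))} = {fun _ => true} := by
    ext χ
    simp [Set.eq_univ_iff_forall, funext_iff]
  unfold IsCompactFamily
  rw [this]
  exact isCompact_singleton

theorem IsCompactFamily.union {C D : Set (Set ℕ)} (hC : IsCompactFamily C)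
    (hD : IsCompactFamily D) : IsCompactFamily (C ∪ D) :=
  IsCompact.union hC hD

theorem IsMultiplePathway.exists_isStrongPPoint (hp : IsMultiplePathway κ r f S) :
    ∃ U : Ultrafilter ℕ, IsStrongPPoint U := by
  obtain ⟨U, hcof, hU⟩ := (hp.centered_generators (Ordinal.omega.{u} 1)).exists_ultrafilter
  refine ⟨U, hcof, fun C hC => ?_⟩
  -- Pass to an increasing sequence of compact families with `ω` in the first one.
  let D : ℕ → Set (Set ℕ) := fun n => n.rec (C 0 ∪ {Set.univ}) fun k Dk => Dk ∪ C (k + 1)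
  have hDmono : Monotone D := monotone_nat_of_le_succ fun n => Set.subset_union_left
  have hCD : ∀ n, C n ⊆ D n := by
    rintro (_ | n)
    exacts [Set.subset_union_left, Set.subset_union_right]
  have hD : ∀ n, IsCompactFamily (D n) ∧ ∀ A ∈ D n, A ∈ U := by
    intro n
    induction n with
    | zero =>
      refine ⟨(hC 0).1.union isCompactFamily_univ, ?_⟩
      rintro A (hA | rfl)
      exacts [(hC 0).2 A hA, univ_mem]
    | succ n ih =>
      refine ⟨ih.1.union (hC (n + 1)).1, ?_⟩
      rintro A (hA | hA)
      exacts [ih.2 A hA, (hC (n + 1)).2 A hA]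
  obtain ⟨x, hx⟩ := exists_decode_eq (seqLevels D)
  obtain ⟨M, hM, hxM⟩ := hp.exists_goodModel x
  set γ := height M with hγ
  have hγ₁ : γ < Ordinal.omega.{u} 1 := hp.height_lt hM
  have hadm : D ∈ admissible f S γ :=
    ⟨fun n => (hD n).1, hDmono, Set.subset_union_right rfl, M, hM, rfl, x, hx, hxM⟩
  have hmax := maximal_chosen (hp.centered_generators γ)
  have hgen : ∀ A ∈ generators f S γ, A ∈ U := by
    intro A hA
    obtain ⟨β, hβ, h⟩ := mem_generators.1 hA
    exact hU A (mem_generators.2 ⟨β, hβ.trans hγ₁, h⟩)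
  have hpatch : ∀ C' ∈ chosen f S γ, ∀ A ∈ patch (seqLevels C') (f γ), A ∈ U :=
    fun C' hC' A hA => hU A (mem_generators.2 ⟨γ, hγ₁, C', hC', hA⟩)
  have hchosen : D ∈ chosen f S γ := by
    refine hmax.le_of_ge (y := insert D (chosen f S γ))
      ⟨Set.insert_subset hadm hmax.prop.1, fun s hs hfin => ?_⟩ (Set.subset_insert _ _)
      (Set.mem_insert _ _)
    have hsU : ∀ A ∈ s, A ∈ U := by
      intro A hA
      rcases hs hA with hA | hA
      · exact hgen A hA
      · obtain ⟨C', hC', hA⟩ := Set.mem_iUnion₂.1 hA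
        obtain ⟨m, hA⟩ := Set.mem_iUnion.1 hA
        obtain rfl | hC' := hC'
        · exact (hD m).2 A hA
        · exact mem_of_mem_admissible U hcof (hp.strictMono γ hγ₁) (hmax.prop.1 hC')
            (hpatch C' hC') hA
    intro hsfin
    exact Ultrafilter.compl_notMem_iff.2 ((Filter.sInter_mem hfin).2 hsU)
      (hcof hsfin.compl_mem_cofinite)
  refine ⟨fun n => Set.Ico (endpoint (f γ) n) (endpoint (f γ) (n + 1)),
    ⟨endpoint (f γ), endpoint_strictMono (hp.strictMono γ hγ₁), rfl, fun _ => rfl⟩,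
    fun A hA => hpatch D hchosen A (mem_patch_seqLevels.2 fun t => ?_)⟩
  obtain ⟨X, hX, hAX⟩ := hA t
  refine ⟨X, hCD t hX, fun j h₁ h₂ => ?_⟩
  simpa [h₁, h₂] using Set.ext_iff.1 hAX j

end Pathway

end DPathway

theorem mainTheorem3
    (h : ∃ (κ : Cardinal.{u}) (r : DPathway.H κ → DPathway.H κ → Prop)
      (f : Ordinal.{u} → ℕ → ℕ) (S : Set (Set ZFSet.{u})),
      DPathway.IsMultiplePathway κ r f S) :
    ∃ U : Ultrafilter ℕ, DPathway.IsStrongPPoint U := by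
  obtain ⟨κ, r, f, S, hp⟩ := h
  exact hp.exists_isStrongPPoint
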